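/- Let $D$ be a finite set, $r\ge 1$ an integer and $R\subseteq D^r$. An instance of $\mathrm{CSP}(R)$ on $n$ variables is a pair $(X,Y)$ with $|X|=n$ and $Y\subseteq X^r$ (clauses with repeated variables are allowed). A map $\sigma:X\to D$ satisfies the clause $y=(y_1,\dots,y_r)$ if $(\sigma(y_1),\dots,\sigma(y_r))\in R$. For $\varepsilon\in(0,1)$, an $\varepsilon$-sparsifier of $(X,Y)$ is a function $w:Y\to\mathbb{R}_{\ge 0}$ such that for every $\sigma:X\to D$ $$(1-\varepsilon)\,|\{y\in Y:\sigma\text{ satisfies }y\}|\;\le\sum_{y\in Y,\ \sigma\text{ satisfies }y} w(y)\;\le\;(1+\varepsilon)\,|\{y\in Y:\sigma\text{ satisfies }y\}|.$$ The $\varepsilon$-sparsity of $(X,Y)$ is the minimum of $|\{y\in Y:w(y)>0\}|$ over all its $\varepsilon$-sparsifiers $w$, and $\mathrm{SPR}(R,n,\varepsilon)$ is the maximum $\varepsilon$-sparsity of an instance of $\mathrm{CSP}(R)$ on $n$ variables. **Theorem.** For every integer $r\ge 1$ there are constants $c,C>0$ and $N\in\mathbb{N}$, depending only on $r$, such that the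 following holds for every finite set $D$, every $R\subseteq D^r$ and every $\varepsilon\in(0,1)$. 1. $\mathrm{SPR}(R,n,\varepsilon)=\Omega(n^r)$ as $n\to\infty$ (with $R$ and $\varepsilon$ fixed) if and only if there are subsets $D_1,\dots,D_r\subseteq D$ of size exactly $2$ with $|R\cap(D_1\times\cdots\times D_r)|=1$. If such subsets exist, then moreover $\mathrm{SPR}(R,n,\varepsilon)\ge c\,n^r$ for all $n\ge N$. 2. If no such subsets exist, then for all $n\ge 2$ $$\mathrm{SPR}(R,n,\varepsilon)\le C\,\frac{n^{\,r-2^{1-r}}\,(\log n)^6}{\varepsilon^2}.$$ -/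

import Mathlib

open Filter Asymptotics
open scoped NNReal

namespace CSP

/-- A clause `y ∈ X^r` is `R`-satisfied by the assignment `σ : X → D` if
`(σ(y_1), …, σ(y_r)) ∈ R`. -/
def Satisfies {D X : Type*} {r : ℕ} (R : Set (Fin r → D)) (σ : X → D) (y : Fin r → X) : Prop :=
  (fun i => σ (y i)) ∈ R

open Classical in
/-- The `R`-weight of `σ` on the instance `(X, Y)` of `CSP(R)`: the number of clauses of `Y`
that are `R`-satisfied by `σ`. -/
noncomputable def wt {D X : Type*} {r : ℕ} (R : Set (Fin r → D)) (Y : Finset (Fin r → X))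
    (σ : X → D) : ℕ :=
  (Y.filter fun y => Satisfies R σ y).card

open Classical in
/-- The `(R, w)`-weight of `σ` on the instance `(X, Y)`: the total weight of the clauses of `Y`
that are `R`-satisfied by `σ`. -/
noncomputable def weightedWt {D X : Type*} {r : ℕ} (R : Set (Fin r → D))
    (Y : Finset (Fin r → X)) (w : Y → ℝ≥0) (σ : X → D) : ℝ :=
  ∑ y : Y, (w y : ℝ) * (if Satisfies R σ y.1 then 1 else 0)

/-- `w : Y → ℝ≥0` is an `ε`-sparsifier of the instance `(X, Y)` of `CSP(R)`. -/
def IsSparsifier {D X : Type*} {r : ℕ} (R : Set (Fin r → D)) (Y : Finset (Fin r → X)) (ε : ℝ)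
    (w : Y → ℝ≥0) : Prop :=
  ∀ σ : X → D,
    (1 - ε) * (wt R Y σ : ℝ) ≤ weightedWt R Y w σ ∧
      weightedWt R Y w σ ≤ (1 + ε) * (wt R Y σ : ℝ)

/-- The `ε`-sparsity of the instance `(X, Y)` of `CSP(R)`: the minimum support size of an
`ε`-sparsifier. (For `ε ≥ 0` the constant weight `1` is an `ε`-sparsifier, so this is the minimum
of a nonempty set.) -/
noncomputable def sparsity {D X : Type*} {r : ℕ} (R : Set (Fin r → D)) (Y : Finset (Fin r → X))
    (ε : ℝ) : ℕ :=
  sInf {k : ℕ | ∃ w : Y → ℝ≥0, IsSparsifier R Y ε w ∧ {y : Y | 0 < w y}.ncard = k}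

/-- `SPR(R, n, ε)`: the maximum `ε`-sparsity of an instance of `CSP(R)` on `n` variables. The
variables are named `0, …, n - 1`, and the clause sets are the (finitely many) subsets of the
`r`-tuples of variables; repeated variables in a clause are allowed. -/
noncomputable def SPR {D : Type*} {r : ℕ} (R : Set (Fin r → D)) (n : ℕ) (ε : ℝ) : ℕ :=
  (Finset.univ : Finset (Finset (Fin r → Fin n))).sup fun Y => sparsity R Y ε

/-- There are subsets `D_1, …, D_r ⊆ D` of size exactly two with
`|R ∩ (D_1 × ⋯ × D_r)| = 1`. -/
def MeetsBoxOnce {D : Type*} {r : ℕ} (R : Set (Fin r → D)) : Prop :=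
  ∃ S : Fin r → Finset D, (∀ i, (S i).card = 2) ∧
    (R ∩ {a : Fin r → D | ∀ i, a i ∈ S i}).ncard = 1

end CSP

/-! Everything is governed by the chain length of the family of satisfied clause sets.

For the upper bound, deleting at most `d` times the chain length many points leaves a `d`-spread
trace (`exists_spread_trace`). As in Karger's cut counting, a `d`-spread family on `m` points has at
most `(m+1)^(2a)` members of size at most `a*d` (`Spread.card_filter_le`). Hence, for `d` of order
`log m / ε²`, a Chernoff and union bound yields one half of the points that is balanced for every
member at once (`Spread.exists_balanced`). Keeping the deleted points with weight 1, doubling the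
weights on the half and iterating about `log m` times gives a sparsifier of size chain length times
polylogarithmic factors over `ε²` (`exists_weight`).

A long chain yields an equally large set `E` of clauses, each of whose nonempty subsets has exactly
one clause satisfied by some assignment. If `E` contained a box, applying this to the box would
exhibit two-element sets `D_i` meeting `R` once (`boxFree_of_not_meetsBoxOnce`). Otherwise `E` is
box-free, and Erdős's theorem (`BoxFree.card_le`) bounds the chain length by `2 * n^(r - 2^(1-r))`.

Conversely, a box meeting `R` once lets assignments isolate every clause of a complete `r`-partite
instance, so no clause can be dropped (`pow_le_SPR`). -/

namespace CSP

/-! ### Chain length, spread families and the counting of small members -/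

section Chains

open Finset

variable {β : Type*} [DecidableEq β]

/-- `HasChain l G`: there are elements `i₁, …, i_l` and members `c₁, …, c_l` of `G` such that
`c_j` contains `i_j` and avoids `i₁, …, i_{j-1}`. -/
def HasChain : ℕ → Finset (Finset β) → Prop
  | 0, _ => True
  | l + 1, G => ∃ i ∈ G.biUnion id, HasChain l (G.filter fun c => i ∉ c)

theorem HasChain.mono {l : ℕ} {G H : Finset (Finset β)} (h : HasChain l G) (hGH : G ⊆ H) :
    HasChain l H := by
  induction l generalizing G H with
  | zero => trivial
  | succ l ih =>
    obtain ⟨i, hi, h⟩ := h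
    exact ⟨i, biUnion_subset_biUnion_of_subset_left _ hGH hi, ih h (filter_subset_filter _ hGH)⟩

theorem HasChain.le_card {l : ℕ} {G : Finset (Finset β)} (h : HasChain l G) :
    l ≤ (G.biUnion id).card := by
  induction l generalizing G with
  | zero => exact Nat.zero_le _
  | succ l ih =>
    obtain ⟨i, hi, h⟩ := h
    have h1 : (G.filter fun c => i ∉ c).biUnion id ⊆ (G.biUnion id).erase i := by
      intro j hj
      simp only [mem_biUnion, mem_filter, id, mem_erase] at hj ⊢
      obtain ⟨c, ⟨hc, hic⟩, hjc⟩ := hj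
      exact ⟨fun e => hic (e ▸ hjc), c, hc, hjc⟩
    have h2 := (ih h).trans (card_le_card h1)
    rw [card_erase_of_mem hi] at h2
    have h3 := card_pos.2 ⟨i, hi⟩
    omega

/-- Chains on the trace on `Z` and chains of a subfamily living off `Z` can be concatenated. -/
theorem HasChain.add {a b : ℕ} {F G : Finset (Finset β)} {Z : Finset β}
    (ha : HasChain a (F.image fun c => c ∩ Z)) (hb : HasChain b G) (hGF : G ⊆ F)
    (hG : ∀ c ∈ G, Disjoint c Z) : HasChain (a + b) F := by
  induction a generalizing F with
  | zero => simpa using hb.mono hGF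
  | succ a ih =>
    obtain ⟨i, hi, ha⟩ := ha
    simp only [mem_biUnion, mem_image, id] at hi
    obtain ⟨_, ⟨c, hc, rfl⟩, hic⟩ := hi
    rw [mem_inter] at hic
    rw [Nat.succ_add]
    refine ⟨i, mem_biUnion.2 ⟨c, hc, hic.1⟩, ih (ha.mono ?_) ?_⟩
    · intro x hx
      simp only [mem_filter, mem_image] at hx ⊢
      obtain ⟨⟨e, he, rfl⟩, hie⟩ := hx
      exact ⟨e, ⟨he, fun h => hie (mem_inter.2 ⟨h, hic.2⟩)⟩, rfl⟩
    · intro e he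
      exact mem_filter.2 ⟨hGF he, fun h => disjoint_left.1 (hG e he) h hic.2⟩

theorem HasChain.of_trace {l : ℕ} {F : Finset (Finset β)} {Z : Finset β}
    (h : HasChain l (F.image fun c => c ∩ Z)) : HasChain l F :=
  h.add (b := 0) (G := ∅) trivial (empty_subset _) (by simp)

/-- Shattering realizes every trace, so points can be picked in any order. Thus VC dimension is at
most chain length, which makes Sauer–Shelah available. -/
theorem _root_.Finset.Shatters.hasChain {G : Finset (Finset β)} {s : Finset β}
    (h : G.Shatters s) : HasChain s.card G := by
  induction s using Finset.induction_on generalizing G with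
  | empty => exact trivial
  | insert i s hi ih =>
    rw [card_insert_of_notMem hi]
    obtain ⟨c, hc, hci⟩ := h (t := {i}) (by simp)
    have hic : i ∈ c := by
      have : i ∈ insert i s ∩ c := by rw [hci]; simp
      exact (mem_inter.1 this).2
    refine ⟨i, mem_biUnion.2 ⟨c, hc, hic⟩, ih ?_⟩
    intro t ht
    obtain ⟨e, he, het⟩ := h (t := t) (ht.trans (subset_insert _ _))
    have hie : i ∉ e := fun h' => hi (ht (het ▸ mem_inter.2 ⟨mem_insert_self _ _, h'⟩))
    refine ⟨e, mem_filter.2 ⟨he, hie⟩, ?_⟩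
    rw [← het, insert_inter_of_notMem hie]

/-- A chain gives a set of the same size each of whose nonempty subsets meets some member
in exactly one point. -/
theorem HasChain.exists_finset {l : ℕ} {G : Finset (Finset β)} (h : HasChain l G) :
    ∃ E : Finset β, E.card = l ∧ E ⊆ G.biUnion id ∧
      ∀ E' ⊆ E, E'.Nonempty → ∃ c ∈ G, ∃ y ∈ E', ∀ z ∈ E', z ∈ c ↔ z = y := by
  induction l generalizing G with
  | zero =>
    refine ⟨∅, rfl, empty_subset _, fun E' hE' hne => ?_⟩
    rw [subset_empty.1 hE'] at hne
    exact absurd hne not_nonempty_empty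
  | succ l ih =>
    obtain ⟨i, hi, h⟩ := h
    obtain ⟨E, hcard, hE, hsep⟩ := ih h
    have hiE : i ∉ E := by
      intro h'
      obtain ⟨c, hc, hic⟩ := mem_biUnion.1 (hE h')
      exact (mem_filter.1 hc).2 hic
    refine ⟨insert i E, by rw [card_insert_of_notMem hiE, hcard], ?_, ?_⟩
    · exact insert_subset hi
        (hE.trans (biUnion_subset_biUnion_of_subset_left _ (filter_subset _ _)))
    · intro E' hE' hne
      -- The members separating later points avoid `i`, so they still isolate one point when `i` is
      -- put back.
      by_cases hs : (E'.erase i).Nonempty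
      · obtain ⟨c, hc, y, hy, hcy⟩ := hsep (E'.erase i) (subset_insert_iff.1 hE') hs
        rw [mem_filter] at hc
        refine ⟨c, hc.1, y, mem_of_mem_erase hy, fun z hz => ?_⟩
        by_cases hzi : z = i
        · subst hzi
          exact ⟨fun h' => absurd h' hc.2, fun h' => absurd h'.symm (ne_of_mem_erase hy)⟩
        · exact hcy z (mem_erase.2 ⟨hzi, hz⟩)
      · have hall : ∀ z ∈ E', z = i := fun z hz => by
          by_contra hzi
          exact hs ⟨z, mem_erase.2 ⟨hzi, hz⟩⟩
        obtain ⟨y, hy⟩ := hne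
        obtain ⟨c, hc, hic⟩ := mem_biUnion.1 hi
        refine ⟨c, hc, y, hy, fun z hz => ?_⟩
        rw [hall z hz, hall y hy]
        exact ⟨fun _ => rfl, fun _ => hic⟩

open Classical in
/-- The length of a longest chain of a set family. -/
noncomputable def chainLength (G : Finset (Finset β)) : ℕ :=
  Nat.findGreatest (fun l => HasChain l G) (G.biUnion id).card

theorem hasChain_chainLength (G : Finset (Finset β)) : HasChain (chainLength G) G := by
  classical
  exact Nat.findGreatest_spec (P := fun l => HasChain l G) (Nat.zero_le _) trivial

theorem HasChain.le_chainLength {l : ℕ} {G : Finset (Finset β)} (h : HasChain l G) :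
    l ≤ chainLength G := by
  classical
  exact Nat.le_findGreatest h.le_card h

theorem chainLength_mono {G H : Finset (Finset β)} (h : G ⊆ H) :
    chainLength G ≤ chainLength H :=
  ((hasChain_chainLength G).mono h).le_chainLength

theorem chainLength_le_card (G : Finset (Finset β)) : chainLength G ≤ (G.biUnion id).card :=
  (hasChain_chainLength G).le_card

theorem chainLength_trace_le (F : Finset (Finset β)) (Z : Finset β) :
    chainLength (F.image fun c => c ∩ Z) ≤ chainLength F :=
  (hasChain_chainLength _).of_trace.le_chainLength

theorem chainLength_filter_lt {G : Finset (Finset β)} {i : β} (hi : i ∈ G.biUnion id) :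
    chainLength (G.filter fun c => i ∉ c) < chainLength G :=
  HasChain.le_chainLength (l := chainLength (G.filter fun c => i ∉ c) + 1)
    ⟨i, hi, hasChain_chainLength _⟩

/-- A family is `d`-spread if every subfamily has support at least `d` times its chain length. -/
def Spread (d : ℕ) (F : Finset (Finset β)) : Prop :=
  ∀ G ⊆ F, d * chainLength G ≤ (G.biUnion id).card

theorem Spread.mono {d : ℕ} {F G : Finset (Finset β)} (h : Spread d F) (hG : G ⊆ F) :
    Spread d G := fun H hH => h H (hH.trans hG)

theorem Spread.le_card {d : ℕ} {F : Finset (Finset β)} (h : Spread d F) {c : Finset β}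
    (hc : c ∈ F) (hne : c.Nonempty) : d ≤ c.card := by
  have h1 := h {c} (singleton_subset_iff.2 hc)
  rw [singleton_biUnion, id] at h1
  obtain ⟨i, hi⟩ := hne
  have h2 : 1 ≤ chainLength {c} :=
    HasChain.le_chainLength (l := 1) ⟨i, by simpa using hi, trivial⟩
  nlinarith

/-- Removing few points from the ground set makes a family spread. -/
theorem exists_spread_trace (d : ℕ) (F : Finset (Finset β)) (Z : Finset β) :
    ∃ Z' ⊆ Z, (Z \ Z').card ≤ d * chainLength (F.image fun c => c ∩ Z) ∧
      Spread d (F.image fun c => c ∩ Z') := by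
  induction hk : chainLength (F.image fun c => c ∩ Z) using Nat.strong_induction_on
    generalizing Z with
  | _ k ih =>
    by_cases hs : Spread d (F.image fun c => c ∩ Z)
    · exact ⟨Z, Subset.rfl, by simp, hs⟩
    · unfold Spread at hs
      push Not at hs
      -- Delete the support of the violating `G`: it costs fewer than `d * chainLength G` points,
      -- and by `HasChain.add` the chain length of the trace falls by at least `chainLength G`.
      obtain ⟨G, hG, hlt⟩ := hs
      set I := G.biUnion id with hI
      have hIZ : I ⊆ Z := by
        intro i hi
        obtain ⟨c, hc, hic⟩ := mem_biUnion.1 hi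
        obtain ⟨e, -, rfl⟩ := mem_image.1 (hG hc)
        exact (mem_inter.1 hic).2
      have htr : (F.image fun c => c ∩ Z).image (fun c => c ∩ (Z \ I)) =
          F.image fun c => c ∩ (Z \ I) := by
        rw [image_image]
        congr 1
        funext c
        simp only [Function.comp, inter_assoc]
        rw [inter_eq_right.2 (sdiff_subset : Z \ I ⊆ Z)]
      have hsum : chainLength (F.image fun c => c ∩ (Z \ I)) + chainLength G ≤ k := by
        rw [← hk, ← htr]
        refine ((hasChain_chainLength _).add (hasChain_chainLength G) hG ?_).le_chainLength
        intro c hc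
        exact disjoint_sdiff.mono_left (subset_biUnion_of_mem id hc)
      have hpos : 0 < chainLength G := by
        rcases Nat.eq_zero_or_pos (chainLength G) with h0 | h0
        · rw [h0] at hlt; omega
        · exact h0
      obtain ⟨Z', hZ', hcard, hsp⟩ := ih _ (by omega) (Z \ I) rfl
      refine ⟨Z', hZ'.trans sdiff_subset, ?_, hsp⟩
      have h1 : Z \ Z' ⊆ I ∪ ((Z \ I) \ Z') := by
        intro x hx
        simp only [Finset.mem_sdiff, mem_union] at hx ⊢
        tauto
      calc (Z \ Z').card ≤ I.card + ((Z \ I) \ Z').card :=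
            (card_le_card h1).trans (card_union_le _ _)
        _ ≤ d * chainLength G + d * chainLength (F.image fun c => c ∩ (Z \ I)) :=
            add_le_add hlt.le hcard
        _ = d * (chainLength (F.image fun c => c ∩ (Z \ I)) + chainLength G) := by ring
        _ ≤ d * k := Nat.mul_le_mul_left _ hsum

theorem card_le_pow_of_chainLength_le [Fintype β] {G : Finset (Finset β)} {a : ℕ}
    (h : chainLength G ≤ a) : G.card ≤ (Fintype.card β + 1) ^ a := by
  have hvc : G.vcDim ≤ a := by
    refine Finset.sup_le fun s hs => ?_
    exact ((mem_shatterer.1 hs).hasChain.le_chainLength).trans h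
  calc G.card ≤ ∑ k ∈ Iic G.vcDim, (Fintype.card β).choose k :=
        (card_le_card_shatterer G).trans card_shatterer_le_sum_vcDim
    _ ≤ ∑ k ∈ range (a + 1), (Fintype.card β).choose k := by
        refine sum_le_sum_of_subset fun k hk => ?_
        rw [mem_Iic] at hk
        rw [mem_range]
        omega
    _ ≤ ∑ k ∈ range (a + 1), Fintype.card β ^ k * 1 ^ (a - k) * a.choose k := by
        refine sum_le_sum fun k hk => ?_
        rw [mem_range] at hk
        have := Nat.choose_pos (show k ≤ a by omega)
        rw [one_pow, mul_one]
        exact (Nat.choose_le_pow _ _).trans (Nat.le_mul_of_pos_right _ this)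
    _ = (Fintype.card β + 1) ^ a := (add_pow _ _ _).symm

/-- The number of members of size at most `a * d` of a `d`-spread family. -/
theorem Spread.card_filter_le_aux [Fintype β] {d : ℕ} (hd : 0 < d) (a l : ℕ)
    {G : Finset (Finset β)} (hG : Spread d G) (hl : chainLength G ≤ l) :
    (G.filter fun c => c.card ≤ a * d).card ≤ (Fintype.card β + 1) ^ a * (max l a).choose a := by
  induction l generalizing G with
  | zero =>
    simp only [Nat.zero_max, Nat.choose_self, mul_one]
    exact (card_filter_le _ _).trans (card_le_pow_of_chainLength_le (hl.trans (Nat.zero_le _)))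
  | succ l ih =>
    rcases Nat.lt_or_ge l a with hla | hla
    · rw [max_eq_right hla, Nat.choose_self, mul_one]
      exact (card_filter_le _ _).trans (card_le_pow_of_chainLength_le (hl.trans hla))
    rw [max_eq_left (hla.trans (Nat.le_succ l))]
    rw [max_eq_left hla] at ih
    rcases Nat.lt_or_ge l (chainLength G) with hlt | hle
    swap
    · exact (ih hG hle).trans (Nat.mul_le_mul_left _ (Nat.choose_le_succ l a))
    have hGl : chainLength G = l + 1 := le_antisymm hl hlt
    set P := (Fintype.card β + 1) ^ a
    set S := G.biUnion id with hS
    set N := (G.filter fun c => c.card ≤ a * d) with hN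
    have hM : d * (l + 1) ≤ S.card := hGl ▸ hG G Subset.rfl
    -- Karger's contraction as a double count: pass to the members avoiding a point `i` of the
    -- support. The chain length drops, and a member of size at most `a * d` survives for all but `a
    -- * d` choices of `i`.
    have hdouble : ∑ i ∈ S, ((G.filter fun c => i ∉ c).filter fun c => c.card ≤ a * d).card =
        ∑ c ∈ N, (S.card - c.card) := by
      have h1 : ∀ i ∈ S, ((G.filter fun c => i ∉ c).filter fun c => c.card ≤ a * d).card =
          ∑ c ∈ N, if i ∉ c then 1 else 0 := by
        intro i _
        rw [← card_filter, hN, filter_filter, filter_filter]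
        congr 1
        ext c
        simp only [mem_filter]
        tauto
      rw [sum_congr rfl h1, sum_comm]
      refine sum_congr rfl fun c hc => ?_
      have hcS : c ⊆ S := subset_biUnion_of_mem id (mem_filter.1 hc).1
      rw [← card_filter, ← card_sdiff_of_subset hcS]
      congr 1
      ext i
      simp
    have hupper : ∑ i ∈ S, ((G.filter fun c => i ∉ c).filter fun c => c.card ≤ a * d).card ≤
        S.card * (P * l.choose a) := by
      rw [← smul_eq_mul]
      refine sum_le_card_nsmul _ _ _ fun i hi => ?_
      have := chainLength_filter_lt hi
      exact ih (hG.mono (filter_subset _ _)) (by omega)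
    have hlower : N.card * (S.card - a * d) ≤ ∑ c ∈ N, (S.card - c.card) := by
      rw [← smul_eq_mul]
      refine card_nsmul_le_sum _ _ _ fun c hc => ?_
      have := (mem_filter.1 hc).2
      omega
    have hkey : N.card * (S.card - a * d) ≤ S.card * (P * l.choose a) := by
      rw [hdouble] at hupper
      exact hlower.trans hupper
    have hchoose := Nat.choose_mul_succ_eq l a
    -- Spreadness gives `v ≥ d * u`, so `(a*d + v) / v ≤ (a + u) / u`, which is the ratio of
    -- `(l+1).choose a` to `l.choose a`.
    obtain ⟨u, hu⟩ : ∃ u, l + 1 = a + u := ⟨l + 1 - a, by omega⟩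
    have hupos : 0 < u := by omega
    obtain ⟨v, hv⟩ : ∃ v, S.card = a * d + v := ⟨S.card - a * d, by
      have : a * d ≤ d * (l + 1) := by rw [mul_comm]; exact Nat.mul_le_mul_left _ (by omega)
      omega⟩
    have hdu : d * u ≤ v := by
      rw [hu, mul_add, mul_comm d a] at hM
      omega
    have hvpos : 0 < v := (Nat.mul_pos hd hupos).trans_le hdu
    rw [show S.card - a * d = v by omega, hv] at hkey
    rw [show l + 1 - a = u by omega, hu] at hchoose
    change N.card ≤ P * (l + 1).choose a
    rw [hu]
    refine Nat.le_of_mul_le_mul_right ?_ (Nat.mul_pos hvpos (show 0 < a + u by omega))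
    calc N.card * (v * (a + u)) = (N.card * v) * (a + u) := by ring
      _ ≤ ((a * d + v) * (P * l.choose a)) * (a + u) := Nat.mul_le_mul_right _ hkey
      _ = (a * d + v) * P * (l.choose a * (a + u)) := by ring
      _ = P * (a + u).choose a * (a * (d * u) + v * u) := by rw [hchoose]; ring
      _ ≤ P * (a + u).choose a * (a * v + v * u) := by gcongr
      _ = P * (a + u).choose a * (v * (a + u)) := by ring

theorem Spread.card_filter_le [Fintype β] {d : ℕ} (hd : 0 < d) (a : ℕ)
    {G : Finset (Finset β)} (hG : Spread d G) :
    (G.filter fun c => c.card ≤ a * d).card ≤ (Fintype.card β + 1) ^ (2 * a) := by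
  rcases Nat.lt_or_ge (chainLength G) a with h | h
  · refine (Finset.card_filter_le _ _).trans ((card_le_pow_of_chainLength_le h.le).trans ?_)
    exact Nat.pow_le_pow_right (Nat.succ_pos _) (by omega)
  · refine (hG.card_filter_le_aux hd a _ le_rfl).trans ?_
    rw [max_eq_left h, two_mul, pow_add]
    refine Nat.mul_le_mul_left _ ((Nat.choose_le_pow _ _).trans (Nat.pow_le_pow_left ?_ _))
    exact (chainLength_le_card G).trans ((card_le_univ _).trans (Nat.le_succ _))

end Chains

/-! ### Random halving with small relative discrepancy -/

section Sparsify

open Finset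

variable {β : Type*} [DecidableEq β] [Fintype β]

/-- The moment generating function of the discrepancy of `c` under a uniformly random subset. -/
theorem sum_exp_discrepancy_le (c : Finset β) (t : ℝ) :
    ∑ S : Finset β, Real.exp (t * (2 * ((c ∩ S).card : ℝ) - c.card)) ≤
      2 ^ Fintype.card β * Real.exp (t ^ 2 / 2 * c.card) := by
  have h1 : ∀ S : Finset β, Real.exp (t * (2 * ((c ∩ S).card : ℝ) - c.card)) =
      (∏ i ∈ S, if i ∈ c then Real.exp t else 1) *
        ∏ i ∈ univ \ S, if i ∈ c then Real.exp (-t) else 1 := by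
    intro S
    rw [prod_ite, prod_ite, prod_const_one, prod_const_one, mul_one, mul_one, prod_const,
      prod_const, ← Real.exp_nat_mul, ← Real.exp_nat_mul, ← Real.exp_add]
    have e1 : S.filter (fun i => i ∈ c) = c ∩ S := by ext; simp [and_comm]
    have e2 : (univ \ S).filter (fun i => i ∈ c) = c \ S := by ext; simp [and_comm]
    have e3 : ((c \ S).card : ℝ) = c.card - (c ∩ S).card := by
      rw [eq_sub_iff_add_eq]
      exact_mod_cast card_sdiff_add_card_inter c S
    rw [e1, e2, e3]
    congr 1
    ring
  have h2 := prod_add (fun i => if i ∈ c then Real.exp t else 1)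
    (fun i => if i ∈ c then Real.exp (-t) else 1) (univ : Finset β)
  rw [powerset_univ] at h2
  rw [sum_congr rfl fun S _ => h1 S, ← h2]
  calc ∏ i : β, ((if i ∈ c then Real.exp t else 1) + if i ∈ c then Real.exp (-t) else 1)
      ≤ ∏ i : β, (2 * if i ∈ c then Real.exp (t ^ 2 / 2) else 1) := by
        refine prod_le_prod (fun i _ => by positivity) fun i _ => ?_
        split_ifs
        -- Each point of `c` contributes `exp t + exp (-t) = 2 * cosh t`.
        · have := Real.cosh_le_exp_half_sq t
          rw [Real.cosh_eq] at this
          linarith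
        · norm_num
    _ = 2 ^ Fintype.card β * Real.exp (t ^ 2 / 2 * c.card) := by
        rw [prod_mul_distrib, prod_const, card_univ, prod_ite, prod_const_one, mul_one,
          prod_const, ← Real.exp_nat_mul, filter_mem_eq_inter, univ_inter, mul_comm (t ^ 2 / 2)]

/-- Chernoff bound for the discrepancy of `c` under a uniformly random subset. -/
theorem card_discrepancy_gt_le (c : Finset β) {ε : ℝ} (hε : 0 < ε) :
    (((univ : Finset (Finset β)).filter fun S =>
      ε * c.card < |2 * ((c ∩ S).card : ℝ) - c.card|).card : ℝ) ≤
      2 ^ Fintype.card β * (2 * Real.exp (-(ε ^ 2 / 2 * c.card))) := by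
  set B := (univ : Finset (Finset β)).filter fun S =>
      ε * c.card < |2 * ((c ∩ S).card : ℝ) - c.card| with hB
  have h1 : (B.card : ℝ) * Real.exp (ε * (ε * c.card)) ≤
      ∑ S : Finset β, (Real.exp (ε * (2 * ((c ∩ S).card : ℝ) - c.card)) +
        Real.exp (-ε * (2 * ((c ∩ S).card : ℝ) - c.card))) := by
    calc (B.card : ℝ) * Real.exp (ε * (ε * c.card))
        ≤ ∑ S ∈ B, (Real.exp (ε * (2 * ((c ∩ S).card : ℝ) - c.card)) +
          Real.exp (-ε * (2 * ((c ∩ S).card : ℝ) - c.card))) := by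
          rw [← nsmul_eq_mul]
          refine card_nsmul_le_sum _ _ _ fun S hS => ?_
          have hS' := (mem_filter.1 hS).2
          rcases lt_abs.1 hS' with h | h
          · have := Real.exp_le_exp.2 (mul_le_mul_of_nonneg_left h.le hε.le)
            have := Real.exp_pos (-ε * (2 * ((c ∩ S).card : ℝ) - c.card))
            linarith
          · have := Real.exp_le_exp.2 (mul_le_mul_of_nonneg_left h.le hε.le)
            rw [mul_neg, ← neg_mul] at this
            have := Real.exp_pos (ε * (2 * ((c ∩ S).card : ℝ) - c.card))
            linarith
      _ ≤ _ := sum_le_sum_of_subset_of_nonneg (subset_univ _) fun _ _ _ => by positivity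
  rw [sum_add_distrib] at h1
  have h2 := sum_exp_discrepancy_le c ε
  have h3 := sum_exp_discrepancy_le c (-ε)
  rw [neg_sq] at h3
  have h4 : (B.card : ℝ) * Real.exp (ε * (ε * c.card)) ≤
      2 ^ Fintype.card β * (2 * Real.exp (ε ^ 2 / 2 * c.card)) := by linarith
  have h5 : 2 ^ Fintype.card β * (2 * Real.exp (ε ^ 2 / 2 * c.card)) =
      2 ^ Fintype.card β * (2 * Real.exp (-(ε ^ 2 / 2 * c.card))) *
        Real.exp (ε * (ε * c.card)) := by
    rw [mul_assoc, mul_assoc, ← Real.exp_add]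
    congr 3
    ring
  rw [h5] at h4
  exact le_of_mul_le_mul_right h4 (Real.exp_pos _)

/-- The union bound over a spread family. -/
theorem Spread.sum_exp_lt_one {d : ℕ} (hd : 0 < d) {F : Finset (Finset β)} (hF : Spread d F)
    {ε : ℝ} (hdε : 12 * Real.log (Fintype.card β + 1) ≤ ε ^ 2 * d) :
    ∑ c ∈ F.filter (fun c => c.Nonempty), 2 * Real.exp (-(ε ^ 2 / 2 * c.card)) < 1 := by
  set m := Fintype.card β with hm
  set F' := F.filter (fun c => c.Nonempty) with hF'
  -- Group members by `a = |c| / d`, which is at least 1 by spreadness. A group has at most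
  -- `(m+1)^(2(a+1)) ≤ (m+1)^(4a)` members, each contributing at most `2 * (m+1)^(-6a)`. The `m`
  -- groups then total at most `2m / (m+1)^2 < 1`.
  have hmaps : ∀ c ∈ F', c.card / d ∈ Icc 1 m := by
    intro c hc
    rw [mem_filter] at hc
    rw [mem_Icc]
    refine ⟨(Nat.one_le_div_iff hd).2 (hF.le_card hc.1 hc.2), (Nat.div_le_self _ _).trans ?_⟩
    exact card_le_univ c
  rw [← sum_fiberwise_of_maps_to hmaps]
  have hm1 : (1 : ℝ) ≤ (m : ℝ) + 1 := by linarith [Nat.cast_nonneg (α := ℝ) m]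
  have hfib : ∀ a ∈ Icc 1 m, ∑ c ∈ F' with c.card / d = a,
      2 * Real.exp (-(ε ^ 2 / 2 * c.card)) ≤ 2 * (1 / ((m : ℝ) + 1) ^ 2) := by
    intro a ha
    rw [mem_Icc] at ha
    have hcard : ((F'.filter fun c => c.card / d = a).card : ℝ) ≤ ((m : ℝ) + 1) ^ (4 * a) := by
      have h1 : (F'.filter fun c => c.card / d = a) ⊆ F.filter fun c => c.card ≤ (a + 1) * d := by
        intro c hc
        simp only [hF', mem_filter] at hc ⊢
        refine ⟨hc.1.1, ?_⟩
        have := Nat.lt_div_mul_add (a := c.card) hd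
        rw [hc.2] at this
        rw [add_mul, one_mul]
        exact this.le
      have h2 := (card_le_card h1).trans (hF.card_filter_le hd (a + 1))
      have h3 : (Fintype.card β + 1) ^ (2 * (a + 1)) ≤ (Fintype.card β + 1) ^ (4 * a) :=
        Nat.pow_le_pow_right (Nat.succ_pos _) (by omega)
      exact_mod_cast h2.trans h3
    have hterm : ∀ c ∈ F'.filter (fun c => c.card / d = a),
        2 * Real.exp (-(ε ^ 2 / 2 * c.card)) ≤ 2 * (1 / ((m : ℝ) + 1) ^ (6 * a)) := by
      intro c hc
      have hca : a * d ≤ c.card := by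
        rw [← (mem_filter.1 hc).2]
        exact Nat.div_mul_le_self _ _
      have hca' : (a : ℝ) * d ≤ c.card := by exact_mod_cast hca
      have hlog : (6 * a : ℕ) * Real.log ((m : ℝ) + 1) ≤ ε ^ 2 / 2 * c.card := by
        push_cast
        have h1 : ε ^ 2 / 2 * ((a : ℝ) * d) ≤ ε ^ 2 / 2 * c.card :=
          mul_le_mul_of_nonneg_left hca' (by positivity)
        have h2 := mul_le_mul_of_nonneg_left hdε (Nat.cast_nonneg (α := ℝ) a)
        linarith
      have : Real.exp (-(ε ^ 2 / 2 * c.card)) ≤ 1 / ((m : ℝ) + 1) ^ (6 * a) := by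
        rw [one_div, ← Real.exp_log (show (0 : ℝ) < (m : ℝ) + 1 by linarith),
          ← Real.exp_nat_mul, ← Real.exp_neg, Real.exp_le_exp]
        linarith
      linarith
    refine (sum_le_card_nsmul _ _ _ hterm).trans ?_
    rw [nsmul_eq_mul]
    have hpow : ((m : ℝ) + 1) ^ (6 * a) = ((m : ℝ) + 1) ^ (4 * a) * ((m : ℝ) + 1) ^ (2 * a) := by
      rw [← pow_add]; congr 1; ring
    have hpos : (0 : ℝ) < ((m : ℝ) + 1) ^ (4 * a) := by positivity
    calc ((F'.filter fun c => c.card / d = a).card : ℝ) * (2 * (1 / ((m : ℝ) + 1) ^ (6 * a)))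
        ≤ ((m : ℝ) + 1) ^ (4 * a) * (2 * (1 / ((m : ℝ) + 1) ^ (6 * a))) := by gcongr
      _ = 2 * (1 / ((m : ℝ) + 1) ^ (2 * a)) := by
          rw [hpow]; field_simp
      _ ≤ 2 * (1 / ((m : ℝ) + 1) ^ 2) := by
          gcongr
          omega
  refine (sum_le_sum hfib).trans_lt ?_
  rw [sum_const, Nat.card_Icc, Nat.add_sub_cancel, nsmul_eq_mul, ← mul_assoc, mul_one_div,
    div_lt_one (by positivity)]
  nlinarith [sq_nonneg (m : ℝ)]

/-- A spread family has a balanced two-colouring with small relative discrepancy. -/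
theorem Spread.exists_balanced {d : ℕ} (hd : 0 < d) {F : Finset (Finset β)} (hF : Spread d F)
    {ε : ℝ} (hε : 0 < ε) (hdε : 12 * Real.log (Fintype.card β + 1) ≤ ε ^ 2 * d) :
    ∃ S : Finset β, ∀ c ∈ F, |2 * ((c ∩ S).card : ℝ) - c.card| ≤ ε * c.card := by
  by_contra! hcon
  have hcover : (univ : Finset (Finset β)) ⊆ (F.filter fun c => c.Nonempty).biUnion fun c =>
      univ.filter fun S => ε * c.card < |2 * ((c ∩ S).card : ℝ) - c.card| := by
    intro S _
    obtain ⟨c, hc, hlt⟩ := hcon S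
    refine mem_biUnion.2 ⟨c, mem_filter.2 ⟨hc, ?_⟩, mem_filter.2 ⟨mem_univ _, hlt⟩⟩
    by_contra hne
    rw [not_nonempty_iff_eq_empty] at hne
    simp [hne] at hlt
  have h1 := (card_le_card hcover).trans card_biUnion_le
  rw [card_univ, Fintype.card_finset] at h1
  have h2 : (2 : ℝ) ^ Fintype.card β ≤ ∑ c ∈ F.filter (fun c => c.Nonempty),
      2 ^ Fintype.card β * (2 * Real.exp (-(ε ^ 2 / 2 * c.card))) := by
    calc (2 : ℝ) ^ Fintype.card β ≤ ((∑ c ∈ F.filter (fun c => c.Nonempty),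
          (univ.filter fun S : Finset β =>
            ε * c.card < |2 * ((c ∩ S).card : ℝ) - c.card|).card : ℕ) : ℝ) := by
          exact_mod_cast h1
      _ ≤ _ := by
          rw [Nat.cast_sum]
          exact sum_le_sum fun c _ => card_discrepancy_gt_le c hε
  rw [← mul_sum] at h2
  have h3 := hF.sum_exp_lt_one hd hdε
  have h4 : (0 : ℝ) < 2 ^ Fintype.card β := by positivity
  nlinarith

/-- Iterated halving: a family of chain length at most `k` has a sparsifier supported on
`T * (d * k)` points of a set of fewer than `2 ^ T` points. -/
theorem exists_weight {d k : ℕ} (hd : 0 < d) (F : Finset (Finset β)) (hk : chainLength F ≤ k)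
    {ε : ℝ} (hε : 0 < ε) (hε1 : ε < 1)
    (hdε : 12 * Real.log (Fintype.card β + 1) ≤ ε ^ 2 * d) (T : ℕ) (Z : Finset β)
    (hZ : Z.card < 2 ^ T) :
    ∃ w : β → ℝ≥0, (Z.filter fun i => 0 < w i).card ≤ T * (d * k) ∧
      ∀ c ∈ F, (1 - ε) ^ T * ((c ∩ Z).card : ℝ) ≤ ∑ i ∈ c ∩ Z, (w i : ℝ) ∧
        ∑ i ∈ c ∩ Z, (w i : ℝ) ≤ (1 + ε) ^ T * ((c ∩ Z).card : ℝ) := by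
  induction T generalizing Z with
  | zero =>
    have : Z = ∅ := by rw [← card_eq_zero]; simpa using hZ
    subst this
    exact ⟨0, by simp, by simp⟩
  | succ T ih =>
    obtain ⟨Z', hZ', hcard, hsp⟩ := exists_spread_trace d F Z
    obtain ⟨S₀, hS₀⟩ := hsp.exists_balanced hd hε hdε
    -- Complementing within `Z'` only flips the sign of the discrepancy, so the smaller half may be
    -- taken.
    obtain ⟨S, hSZ, hS2, hS⟩ : ∃ S ⊆ Z', 2 * S.card ≤ Z'.card ∧
        ∀ c ∈ F, |2 * ((c ∩ S).card : ℝ) - (c ∩ Z').card| ≤ ε * (c ∩ Z').card := by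
      have hsplit := card_sdiff_add_card_inter Z' S₀
      rcases le_total (Z' ∩ S₀).card (Z' \ S₀).card with h | h
      · refine ⟨Z' ∩ S₀, inter_subset_left, by omega, fun c hc => ?_⟩
        have := hS₀ _ (mem_image_of_mem _ hc)
        rwa [inter_assoc] at this
      · refine ⟨Z' \ S₀, sdiff_subset, by omega, fun c hc => ?_⟩
        have h1 := hS₀ _ (mem_image_of_mem _ hc)
        have h2 : (((c ∩ Z') \ S₀).card : ℝ) + ((c ∩ Z') ∩ S₀).card = (c ∩ Z').card := by
          exact_mod_cast card_sdiff_add_card_inter (c ∩ Z') S₀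
        rw [← inter_sdiff_assoc, abs_sub_comm]
        convert h1 using 2
        linarith
    have hle := card_le_card hZ'
    obtain ⟨w, hw, hwF⟩ := ih S (by rw [pow_succ] at hZ; omega)
    have hSZ2 : S ⊆ Z := hSZ.trans hZ'
    set w' : β → ℝ≥0 := fun i => if i ∈ S then 2 * w i else if i ∈ Z' then 0 else 1 with hw'
    refine ⟨w', ?_, fun c hc => ?_⟩
    · have hsub : (Z.filter fun i => 0 < w' i) ⊆ (Z \ Z') ∪ S.filter fun i => 0 < w i := by
        intro i hi
        simp only [mem_filter, hw', mem_union, Finset.mem_sdiff] at hi ⊢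
        obtain ⟨hiZ, hi⟩ := hi
        split_ifs at hi with h1 h2
        · exact Or.inr ⟨h1, by simpa using hi⟩
        · exact absurd hi (lt_irrefl _)
        · exact Or.inl ⟨hiZ, h2⟩
      have h1 : d * chainLength (F.image fun c => c ∩ Z) ≤ d * k :=
        Nat.mul_le_mul_left _ ((chainLength_trace_le F Z).trans hk)
      calc (Z.filter fun i => 0 < w' i).card
          ≤ (Z \ Z').card + (S.filter fun i => 0 < w i).card :=
            (card_le_card hsub).trans (card_union_le _ _)
        _ ≤ d * k + T * (d * k) := add_le_add (hcard.trans h1) hw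
        _ = (T + 1) * (d * k) := by ring
    · have hsum : ∑ i ∈ c ∩ Z, (w' i : ℝ) =
          ((c ∩ (Z \ Z')).card : ℝ) + 2 * ∑ i ∈ c ∩ S, (w i : ℝ) := by
        have hval : ∀ i ∈ c ∩ Z, (w' i : ℝ) =
            (if i ∈ Z \ Z' then 1 else 0) + if i ∈ S then 2 * (w i : ℝ) else 0 := by
          intro i hi
          have hiZ := (mem_inter.1 hi).2
          simp only [hw', Finset.mem_sdiff]
          by_cases h1 : i ∈ S
          · simp [h1, hSZ h1]
          · by_cases h2 : i ∈ Z' <;> simp [h1, h2, hiZ]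
        rw [sum_congr rfl hval, sum_add_distrib, ← sum_filter, ← sum_filter, mul_sum,
          filter_mem_eq_inter, filter_mem_eq_inter, sum_const, nsmul_eq_mul, mul_one,
          inter_assoc, inter_assoc, inter_eq_right.2 (sdiff_subset : Z \ Z' ⊆ Z),
          inter_eq_right.2 hSZ2]
      have hcz : ((c ∩ Z).card : ℝ) = (c ∩ (Z \ Z')).card + (c ∩ Z').card := by
        have h1 := card_sdiff_add_card_inter (c ∩ Z) Z'
        rw [inter_sdiff_assoc, inter_assoc, inter_eq_right.2 hZ'] at h1
        exact_mod_cast h1.symm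
      obtain ⟨hlo, hhi⟩ := hwF c hc
      obtain ⟨hb1, hb2⟩ := abs_le.1 (hS c hc)
      set A : ℝ := (((c ∩ (Z \ Z')).card : ℕ) : ℝ)
      set B : ℝ := (((c ∩ Z').card : ℕ) : ℝ)
      set s : ℝ := (((c ∩ S).card : ℕ) : ℝ)
      set W : ℝ := ∑ i ∈ c ∩ S, (w i : ℝ)
      have hA : 0 ≤ A := Nat.cast_nonneg _
      have hlo1 : (1 - ε) ^ (T + 1) ≤ 1 := pow_le_one₀ (by linarith) (by linarith)
      have hhi1 : 1 ≤ (1 + ε) ^ (T + 1) := one_le_pow₀ (by linarith)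
      have hplo : 0 ≤ (1 - ε) ^ T := pow_nonneg (by linarith) _
      have hphi : 0 ≤ (1 + ε) ^ T := pow_nonneg (by linarith) _
      rw [hsum, hcz]
      constructor
      · have h1 : (1 - ε) ^ T * ((1 - ε) * B) ≤ (1 - ε) ^ T * (2 * s) :=
          mul_le_mul_of_nonneg_left (by linarith) hplo
        have h2 : (1 - ε) ^ (T + 1) * A ≤ 1 * A := mul_le_mul_of_nonneg_right hlo1 hA
        rw [pow_succ] at h2 ⊢
        linarith
      · have h1 : (1 + ε) ^ T * (2 * s) ≤ (1 + ε) ^ T * ((1 + ε) * B) :=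
          mul_le_mul_of_nonneg_left (by linarith) hphi
        have h2 : 1 * A ≤ (1 + ε) ^ (T + 1) * A := mul_le_mul_of_nonneg_right hhi1 hA
        rw [pow_succ] at h2 ⊢
        linarith

end Sparsify

/-! ### Erdős's box theorem -/

section Box

open Finset

variable {X : Type*} [DecidableEq X]

/-- `E` contains no box `{u 0, v 0} × ⋯ × {u (r - 1), v (r - 1)}` with `u i ≠ v i` for all `i`. -/
def BoxFree {r : ℕ} (E : Finset (Fin r → X)) : Prop :=
  ∀ u v : Fin r → X, (∀ i, u i ≠ v i) → ∃ a : Fin r → X, (∀ i, a i = u i ∨ a i = v i) ∧ a ∉ E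

/-- The common link in `E` of the two first coordinates `x` and `x'`. -/
theorem BoxFree.link {r : ℕ} [Fintype X] {E : Finset (Fin (r + 1) → X)} (hE : BoxFree E) {x x' : X}
    (hx : x ≠ x') :
    BoxFree (univ.filter fun z : Fin r → X => Fin.cons x z ∈ E ∧ Fin.cons x' z ∈ E) := by
  intro u v huv
  obtain ⟨a, ha, haE⟩ := hE (Fin.cons x u) (Fin.cons x' v)
    (fun i => Fin.cases (by simpa using hx) (fun i => by simpa using huv i) i)
  refine ⟨Fin.tail a, fun i => by
    have := ha i.succ
    rwa [Fin.cons_succ, Fin.cons_succ] at this, fun hmem => haE ?_⟩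
  rw [mem_filter] at hmem
  rw [← Fin.cons_self_tail a]
  rcases ha 0 with h | h
  · rw [h, Fin.cons_zero]; exact hmem.2.1
  · rw [h, Fin.cons_zero]; exact hmem.2.2

/-- Erdős's bound for the number of edges of a hypergraph without boxes. -/
theorem BoxFree.card_le [Fintype X] [Nonempty X] {r : ℕ} {E : Finset (Fin r → X)}
    (hE : BoxFree E) :
    (E.card : ℝ) ≤ 2 * (Fintype.card X : ℝ) ^ ((r : ℝ) - (2 : ℝ) ^ (1 - (r : ℝ))) := by
  induction r with
  | zero =>
    obtain ⟨a, -, ha⟩ := hE (fun i => i.elim0) (fun i => i.elim0) (fun i => i.elim0)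
    have : E = ∅ := by
      rw [eq_empty_iff_forall_notMem]
      intro b hb
      exact ha (Subsingleton.elim b a ▸ hb)
    rw [this, card_empty, Nat.cast_zero]
    positivity
  | succ r ih =>
    set n : ℝ := (Fintype.card X : ℝ) with hn
    have hn1 : 1 ≤ n := by rw [hn]; exact Nat.one_le_cast.2 Fintype.card_pos
    have hn0 : 0 < n := by linarith
    set δ : ℝ := (2 : ℝ) ^ (1 - (r : ℝ)) with hδ
    have hδ2 : (2 : ℝ) ^ (1 - ((r + 1 : ℕ) : ℝ)) = δ / 2 := by
      rw [hδ, Nat.cast_succ, ← sub_sub, Real.rpow_sub_one two_ne_zero]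
    have hδ1 : δ ≤ 2 := by
      have : δ ≤ (2 : ℝ) ^ (1 : ℝ) :=
        Real.rpow_le_rpow_of_exponent_le one_le_two (by linarith [Nat.cast_nonneg (α := ℝ) r])
      simpa using this
    rw [hδ2, Nat.cast_succ]
    set N : (Fin r → X) → ℕ := fun z => (univ.filter fun x => (Fin.cons x z : Fin (r + 1) → X) ∈ E).card
      with hN
    have hcardE : E.card = ∑ z : Fin r → X, N z := by
      rw [card_eq_sum_card_fiberwise (f := Fin.tail) (t := univ) (fun _ _ => mem_coe.2 (mem_univ _))]
      refine sum_congr rfl fun z _ => ?_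
      refine card_bij' (fun a _ => a 0) (fun x _ => Fin.cons x z) ?_ ?_ ?_ ?_
      · intro a ha
        rw [mem_filter] at ha
        rw [mem_filter, ← ha.2, Fin.cons_self_tail]
        exact ⟨mem_univ _, ha.1⟩
      · intro x hx
        rw [mem_filter] at hx ⊢
        exact ⟨hx.2, Fin.tail_cons _ _⟩
      · intro a ha
        rw [mem_filter] at ha
        rw [← ha.2, Fin.cons_self_tail]
      · intro x _
        exact Fin.cons_zero _ _
    -- Ordered pairs of distinct first coordinates with a common extension `z`, counted by `z` and
    -- by pair. Links are box-free, so induction bounds the right side.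
    have hpairs : ∑ z : Fin r → X, (N z * N z - N z) =
        ∑ p ∈ (univ : Finset X).offDiag, (univ.filter fun z : Fin r → X =>
          Fin.cons p.1 z ∈ E ∧ Fin.cons p.2 z ∈ E).card := by
      simp only [card_filter]
      rw [sum_comm]
      refine sum_congr rfl fun z _ => ?_
      rw [← card_filter, hN, ← offDiag_card]
      congr 1
      ext p
      simp only [mem_offDiag, mem_filter, mem_univ, true_and]
      tauto
    have hlink : ((∑ z : Fin r → X, (N z * N z - N z) : ℕ) : ℝ) ≤
        n ^ 2 * (2 * n ^ ((r : ℝ) - δ)) := by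
      rw [hpairs, Nat.cast_sum]
      calc _ ≤ ∑ p ∈ (univ : Finset X).offDiag, 2 * n ^ ((r : ℝ) - δ) := by
            refine sum_le_sum fun p hp => ?_
            exact ih (hE.link (mem_offDiag.1 hp).2.2)
        _ ≤ _ := by
            rw [sum_const, nsmul_eq_mul]
            refine mul_le_mul_of_nonneg_right ?_ (by positivity)
            rw [offDiag_card, card_univ, hn, sq]
            exact_mod_cast Nat.sub_le _ _
    have hsq : (E.card : ℝ) ^ 2 ≤ n ^ r * ∑ z : Fin r → X, (N z : ℝ) ^ 2 := by
      have h := sq_sum_le_card_mul_sum_sq (s := (univ : Finset (Fin r → X)))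
        (f := fun z => (N z : ℝ))
      rw [hcardE, Nat.cast_sum]
      refine h.trans_eq ?_
      rw [card_univ, Fintype.card_fun, Fintype.card_fin, Nat.cast_pow]
    have hsub : ((∑ z : Fin r → X, (N z * N z - N z) : ℕ) : ℝ) =
        ∑ z : Fin r → X, (N z : ℝ) ^ 2 - E.card := by
      rw [hcardE, Nat.cast_sum, Nat.cast_sum, ← sum_sub_distrib]
      refine sum_congr rfl fun z _ => ?_
      rw [Nat.cast_sub (Nat.le_mul_self _), Nat.cast_mul, sq]
    rw [hsub] at hlink
    set e : ℝ := (E.card : ℝ) with he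
    set Q : ℝ := ∑ z : Fin r → X, (N z : ℝ) ^ 2
    set A : ℝ := n ^ ((r : ℝ) + 1 - δ / 2) with hA
    have hA0 : 0 < A := Real.rpow_pos_of_pos hn0 _
    have hA1 : n ^ r ≤ A := by
      rw [← Real.rpow_natCast]
      exact Real.rpow_le_rpow_of_exponent_le hn1 (by linarith)
    have hA2 : n ^ r * (n ^ 2 * n ^ ((r : ℝ) - δ)) = A ^ 2 := by
      rw [hA, ← Real.rpow_natCast n r, ← Real.rpow_natCast n 2, ← Real.rpow_add hn0,
        ← Real.rpow_add hn0, ← Real.rpow_natCast _ 2, ← Real.rpow_mul hn0.le]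
      congr 1
      push_cast
      ring
    have hnr : 0 < n ^ r := by positivity
    have he0 : 0 ≤ e := Nat.cast_nonneg _
    have hfin : e ^ 2 ≤ 2 * A ^ 2 + A * e := by
      have h1 : n ^ r * Q ≤ n ^ r * (n ^ 2 * (2 * n ^ ((r : ℝ) - δ)) + e) :=
        mul_le_mul_of_nonneg_left (by linarith) hnr.le
      have h2 : n ^ r * e ≤ A * e := mul_le_mul_of_nonneg_right hA1 he0
      calc e ^ 2 ≤ n ^ r * (n ^ 2 * (2 * n ^ ((r : ℝ) - δ)) + e) := hsq.trans h1
        _ = 2 * (n ^ r * (n ^ 2 * n ^ ((r : ℝ) - δ))) + n ^ r * e := by ring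
        _ ≤ 2 * A ^ 2 + A * e := by rw [hA2]; linarith
    -- `e² - A*e - 2*A² = (e - 2*A)*(e + A)`, so the constant 2 reproduces itself through the
    -- induction.
    by_contra! hlt
    nlinarith

end Box

/-! ### From chains of clauses to boxes in the relation -/

section Redundancy

open Finset

variable {D X : Type*} {r : ℕ}

open Classical in
/-- The family of the sets of clauses of `Y` satisfied by the assignments `X → D`. -/
noncomputable def satFamily [Fintype X] (D : Type*) (R : Set (Fin r → D))
    (Y : Finset (Fin r → X)) : Finset (Finset (Fin r → X)) :=
  univ.filter fun c => ∃ σ : X → D, c = Y.filter fun y => Satisfies R σ y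

open Classical in
/-- If every nonempty part of `E` is met in one clause by some assignment, then a box in `E`
yields a box meeting `R` exactly once. -/
theorem boxFree_of_not_meetsBoxOnce {R : Set (Fin r → D)} (hR : ¬ MeetsBoxOnce R)
    {E : Finset (Fin r → X)}
    (hE : ∀ E' ⊆ E, E'.Nonempty →
      ∃ σ : X → D, ∃ y ∈ E', ∀ z ∈ E', Satisfies R σ z ↔ z = y) : BoxFree E := by
  intro u v huv
  by_contra! hbox
  set E' := E.filter fun a => ∀ i, a i = u i ∨ a i = v i with hE'
  have hmem : ∀ a, a ∈ E' ↔ ∀ i, a i = u i ∨ a i = v i := fun a => by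
    rw [hE', mem_filter]
    exact ⟨fun h => h.2, fun h => ⟨hbox a h, h⟩⟩
  obtain ⟨σ, y, hy, hσ⟩ := hE E' (filter_subset _ _) ⟨u, (hmem u).2 fun i => Or.inl rfl⟩
  have hyR : (fun i => σ (y i)) ∈ R := (hσ y hy).2 rfl
  -- If the two values agreed, switching coordinate `i` of `y` would give a second satisfied clause
  -- of the box.
  have hne : ∀ i, σ (u i) ≠ σ (v i) := by
    intro i hi
    rw [hmem] at hy
    set t : X := if y i = u i then v i else u i with ht
    have hty : t ≠ y i := by
      rw [ht]
      split_ifs with h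
      · rw [h]; exact (huv i).symm
      · exact fun h' => h h'.symm
    have hσt : σ t = σ (y i) := by
      rw [ht]
      split_ifs with h
      · rw [h, hi]
      · rw [(hy i).resolve_left h, hi]
    have hz : Function.update y i t ∈ E' := by
      rw [hmem]
      intro j
      by_cases hj : j = i
      · subst hj
        rw [Function.update_self, ht]
        split_ifs
        · exact Or.inr rfl
        · exact Or.inl rfl
      · rw [Function.update_of_ne hj]
        exact hy j
    have hsat : Satisfies R σ (Function.update y i t) := by
      have : (fun j => σ (Function.update y i t j)) = fun j => σ (y j) := by
        funext j
        by_cases hj : j = i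
        · subst hj; rw [Function.update_self, hσt]
        · rw [Function.update_of_ne hj]
      unfold Satisfies
      rwa [this]
    have h1 := congrFun ((hσ _ hz).1 hsat) i
    rw [Function.update_self] at h1
    exact hty h1
  refine hR ⟨fun i => {σ (u i), σ (v i)}, fun i => card_pair (hne i), ?_⟩
  rw [Set.ncard_eq_one]
  refine ⟨fun i => σ (y i), Set.eq_singleton_iff_unique_mem.2 ⟨⟨hyR, fun i => ?_⟩, ?_⟩⟩
  · rcases (hmem y).1 hy i with h | h <;> simp [h]
  · rintro a ⟨haR, ha⟩
    have hz : ∀ i, ∃ x, (x = u i ∨ x = v i) ∧ σ x = a i := by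
      intro i
      have := ha i
      rw [mem_insert, mem_singleton] at this
      rcases this with h | h
      · exact ⟨u i, Or.inl rfl, h.symm⟩
      · exact ⟨v i, Or.inr rfl, h.symm⟩
    choose z hz hza using hz
    have haz : a = fun i => σ (z i) := funext fun i => (hza i).symm
    have hzy : z = y := (hσ z ((hmem z).2 hz)).1 (by unfold Satisfies; rwa [← haz])
    rw [haz, hzy]

theorem chainLength_satFamily_le [Fintype X] [Nonempty X] [DecidableEq X] {R : Set (Fin r → D)}
    (hR : ¬ MeetsBoxOnce R) (Y : Finset (Fin r → X)) :
    (chainLength (satFamily D R Y) : ℝ) ≤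
      2 * (Fintype.card X : ℝ) ^ ((r : ℝ) - (2 : ℝ) ^ (1 - (r : ℝ))) := by
  classical
  obtain ⟨E, hcard, hEY, hsep⟩ := (hasChain_chainLength (satFamily D R Y)).exists_finset
  rw [← hcard]
  refine BoxFree.card_le (boxFree_of_not_meetsBoxOnce hR fun E' hE' hne => ?_)
  obtain ⟨c, hc, y, hy, h⟩ := hsep E' hE' hne
  obtain ⟨σ, rfl⟩ := (mem_filter.1 hc).2
  refine ⟨σ, y, hy, fun z hz => ?_⟩
  rw [← h z hz, mem_filter]
  refine ⟨fun hs => ⟨?_, hs⟩, fun hs => hs.2⟩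
  obtain ⟨c', hc', hzc'⟩ := mem_biUnion.1 (hEY (hE' hz))
  obtain ⟨σ', rfl⟩ := (mem_filter.1 hc').2
  exact (mem_filter.1 hzc').1

end Redundancy

/-! ### Bounds on sparsity -/

section Sparsity

open Finset

variable {D X : Type*} {r : ℕ}

open Classical in
theorem weightedWt_restrict (R : Set (Fin r → D)) (Y : Finset (Fin r → X))
    (w : (Fin r → X) → ℝ≥0) (σ : X → D) :
    weightedWt R Y (fun y => w y) σ = ∑ y ∈ Y.filter fun y => Satisfies R σ y, (w y : ℝ) := by
  unfold weightedWt
  rw [sum_coe_sort Y fun y => (w y : ℝ) * if Satisfies R σ y then 1 else 0, sum_filter]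
  exact sum_congr rfl fun y _ => by rw [mul_ite, mul_one, mul_zero]

theorem isSparsifier_one (R : Set (Fin r → D)) (Y : Finset (Fin r → X)) {ε : ℝ} (hε : 0 ≤ ε) :
    IsSparsifier R Y ε (fun _ => 1) := by
  intro σ
  have h := weightedWt_restrict R Y (fun _ => 1) σ
  rw [NNReal.coe_one, sum_const, nsmul_eq_mul, mul_one] at h
  rw [h]
  change (1 - ε) * (wt R Y σ : ℝ) ≤ (wt R Y σ : ℝ) ∧ (wt R Y σ : ℝ) ≤ (1 + ε) * (wt R Y σ : ℝ)
  have := mul_nonneg hε (Nat.cast_nonneg (α := ℝ) (wt R Y σ))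
  constructor <;> linarith

theorem sparsity_le (R : Set (Fin r → D)) (Y : Finset (Fin r → X)) {ε : ℝ}
    (w : (Fin r → X) → ℝ≥0) (hw : IsSparsifier R Y ε fun y => w y) :
    sparsity R Y ε ≤ (Y.filter fun y => 0 < w y).card := by
  refine Nat.sInf_le ⟨fun y => w y, hw, ?_⟩
  rw [← Set.ncard_image_of_injective _ Subtype.val_injective, ← Set.ncard_coe_finset]
  congr 1
  ext y
  simp [and_comm]

/-- A sparsifier of a non-redundant instance keeps every clause. -/
theorem card_le_sparsity (R : Set (Fin r → D)) (Y : Finset (Fin r → X)) {ε : ℝ} (hε : 0 ≤ ε)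
    (hε1 : ε < 1) (h : ∀ y ∈ Y, ∃ σ : X → D, ∀ z ∈ Y, Satisfies R σ z ↔ z = y) :
    Y.card ≤ sparsity R Y ε := by
  classical
  obtain ⟨w, hw, hcard⟩ := Nat.sInf_mem
    (s := {k : ℕ | ∃ w : Y → ℝ≥0, IsSparsifier R Y ε w ∧ {y : Y | 0 < w y}.ncard = k})
    ⟨_, fun _ => 1, isSparsifier_one R Y hε, rfl⟩
  have huniv : {y : Y | 0 < w y} = Set.univ := by
    rw [Set.eq_univ_iff_forall]
    -- The assignment isolating `y` forces `w y ≥ 1 - ε > 0`.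
    rintro ⟨y, hy⟩
    obtain ⟨σ, hσ⟩ := h y hy
    have h1 : wt R Y σ = 1 := by
      unfold wt
      rw [card_eq_one]
      refine ⟨y, ?_⟩
      ext z
      rw [mem_filter, mem_singleton]
      exact ⟨fun hz => (hσ z hz.1).1 hz.2, fun hz => hz ▸ ⟨hy, (hσ y hy).2 rfl⟩⟩
    have h2 : weightedWt R Y w σ = w ⟨y, hy⟩ := by
      unfold weightedWt
      rw [sum_eq_single ⟨y, hy⟩]
      · rw [if_pos ((hσ y hy).2 rfl), mul_one]
      · rintro ⟨z, hz⟩ - hne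
        rw [if_neg fun hs => hne (Subtype.ext ((hσ z hz).1 hs)), mul_zero]
      · exact fun hn => absurd (mem_univ _) hn
    have h3 := (hw σ).1
    rw [h1, h2, Nat.cast_one, mul_one] at h3
    have h4 : (0 : ℝ) < w ⟨y, hy⟩ := by linarith
    exact_mod_cast h4
  unfold sparsity
  rw [← hcard, huniv, Set.ncard_univ, Nat.card_eq_fintype_card, Fintype.card_coe]

theorem sparsity_le_SPR (R : Set (Fin r → D)) {n : ℕ} (ε : ℝ) (Y : Finset (Fin r → Fin n)) :
    sparsity R Y ε ≤ SPR R n ε :=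
  le_sup (f := fun Y => sparsity R Y ε) (mem_univ Y)

theorem exists_sparsity_eq_SPR (R : Set (Fin r → D)) (n : ℕ) (ε : ℝ) :
    ∃ Y : Finset (Fin r → Fin n), SPR R n ε = sparsity R Y ε := by
  obtain ⟨Y, -, h⟩ := exists_mem_eq_sup (univ : Finset (Finset (Fin r → Fin n))) univ_nonempty
    fun Y => sparsity R Y ε
  exact ⟨Y, h⟩

/-- The complete `r`-partite instance with parts of size `q` is non-redundant if `R` meets a box
exactly once. -/
theorem pow_le_SPR {R : Set (Fin r → D)} (hR : MeetsBoxOnce R) (hr : 1 ≤ r) {ε : ℝ} (hε : 0 ≤ ε)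
    (hε1 : ε < 1) {n q : ℕ} (hq : r * q ≤ n) : q ^ r ≤ SPR R n ε := by
  classical
  obtain ⟨S, hS, hcard⟩ := hR
  obtain ⟨u, hu⟩ := Set.ncard_eq_one.1 hcard
  have huS : u ∈ R ∩ {a : Fin r → D | ∀ i, a i ∈ S i} := by rw [hu]; rfl
  have hv : ∀ i, ∃ v ∈ S i, v ≠ u i := fun i =>
    exists_mem_ne (by rw [hS i]; exact one_lt_two) (u i)
  choose v hvS hvu using hv
  have hlt : ∀ (i : Fin r) (b : Fin q), finProdFinEquiv (i, b) < n := fun i b =>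
    (finProdFinEquiv (i, b)).2.trans_le hq
  set f : (Fin r → Fin q) → Fin r → Fin n := fun a i => ⟨finProdFinEquiv (i, a i), hlt i (a i)⟩
    with hf
  have hinj : Function.Injective f := by
    intro a b hab
    funext i
    have h1 := congrArg Fin.val (congrFun hab i)
    have h2 := finProdFinEquiv.injective (Fin.ext h1)
    exact (Prod.ext_iff.1 h2).2
  have hcardY : ((univ : Finset (Fin r → Fin q)).image f).card = q ^ r := by
    rw [card_image_of_injective _ hinj, card_univ, Fintype.card_fun, Fintype.card_fin,
      Fintype.card_fin]
  rw [← hcardY]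
  refine (card_le_sparsity R _ hε hε1 fun y hy => ?_).trans (sparsity_le_SPR R ε _)
  obtain ⟨a, -, rfl⟩ := mem_image.1 hy
  -- In part `i`, the vertex chosen by `a` gets `u i` and all others get `v i`. The value outside
  -- the parts is irrelevant.
  set σ : Fin n → D := fun x =>
    if hx : (x : ℕ) < r * q then
      if (finProdFinEquiv.symm ⟨x, hx⟩).2 = a (finProdFinEquiv.symm ⟨x, hx⟩).1 then
        u (finProdFinEquiv.symm ⟨x, hx⟩).1
      else v (finProdFinEquiv.symm ⟨x, hx⟩).1
    else u ⟨0, hr⟩ with hσ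
  have hσf : ∀ b i, σ (f b i) = if b i = a i then u i else v i := by
    intro b i
    simp only [hσ, hf]
    rw [dif_pos (finProdFinEquiv (i, b i)).2]
    simp only [Fin.eta, Equiv.symm_apply_apply]
  refine ⟨σ, fun z hz => ?_⟩
  obtain ⟨b, -, rfl⟩ := mem_image.1 hz
  unfold Satisfies
  simp only [hσf]
  constructor
  · intro hb
    have hbox : (fun i => if b i = a i then u i else v i) ∈
        R ∩ {a : Fin r → D | ∀ i, a i ∈ S i} := by
      refine ⟨hb, fun i => ?_⟩
      change (if b i = a i then u i else v i) ∈ S i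
      split_ifs
      · exact huS.2 i
      · exact hvS i
    rw [hu, Set.mem_singleton_iff] at hbox
    congr 1
    funext i
    by_contra hne
    have := congrFun hbox i
    rw [if_neg hne] at this
    exact hvu i this
  · intro hb
    rw [hinj hb]
    simpa using huS.1

/-- The sparsifier obtained by iterated halving of the instance. -/
theorem sparsity_le_mul_chainLength [Fintype X] [DecidableEq X] (R : Set (Fin r → D))
    (Y : Finset (Fin r → X)) {ε : ℝ} (hε : 0 < ε) (hε1 : ε < 1) {T d : ℕ} (hd : 0 < d)
    (hT : 1 ≤ T) (hY : Y.card < 2 ^ T)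
    (hdε : 12 * Real.log (Fintype.card (Fin r → X) + 1) ≤ (ε / (2 * T)) ^ 2 * d) :
    sparsity R Y ε ≤ T * (d * chainLength (satFamily D R Y)) := by
  -- With `ε' = ε / (2 * T)` the errors of `T` rounds compound to at most `ε`: Bernoulli below, and
  -- `exp (ε / 2) ≤ 1 + ε` above.
  classical
  have hT1' : (1 : ℝ) ≤ T := by exact_mod_cast hT
  set ε' : ℝ := ε / (2 * T) with hε'
  have hε'0 : 0 < ε' := by positivity
  have hTε : (T : ℝ) * ε' = ε / 2 := by rw [hε']; field_simp
  have hε'1 : ε' < 1 := by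
    have : 1 * ε' ≤ T * ε' := mul_le_mul_of_nonneg_right hT1' hε'0.le
    linarith
  obtain ⟨w, hwcard, hw⟩ := exists_weight hd (satFamily D R Y) le_rfl hε'0 hε'1 hdε T Y hY
  have hlo : 1 - ε ≤ (1 - ε') ^ T := by
    have := one_add_mul_le_pow (a := -ε') (by linarith) T
    rw [← sub_eq_add_neg] at this
    linarith
  have hhi : (1 + ε') ^ T ≤ 1 + ε := by
    have h1 : (1 + ε') ^ T ≤ Real.exp (ε / 2) := by
      rw [← hTε, Real.exp_nat_mul]
      exact pow_le_pow_left₀ (by linarith) (by linarith [Real.add_one_le_exp ε']) _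
    have h2 := (abs_le.1 (Real.abs_exp_sub_one_sub_id_le (x := ε / 2)
      (by rw [abs_of_pos] <;> linarith))).2
    nlinarith
  have hsp : IsSparsifier R Y ε fun y => w y := by
    intro σ
    have hmem : (Y.filter fun y => Satisfies R σ y) ∈ satFamily D R Y :=
      mem_filter.2 ⟨mem_univ _, σ, rfl⟩
    obtain ⟨h1, h2⟩ := hw _ hmem
    rw [inter_eq_left.2 (filter_subset _ Y)] at h1 h2
    rw [weightedWt_restrict]
    exact ⟨(mul_le_mul_of_nonneg_right hlo (Nat.cast_nonneg _)).trans h1,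
      h2.trans (mul_le_mul_of_nonneg_right hhi (Nat.cast_nonneg _))⟩
  exact (sparsity_le R Y w hsp).trans hwcard

theorem SPR_le {R : Set (Fin r → D)} (hR : ¬ MeetsBoxOnce R) (hr : 1 ≤ r) {ε : ℝ} (hε : 0 < ε)
    (hε1 : ε < 1) {n : ℕ} (hn : 2 ≤ n) :
    (SPR R n ε : ℝ) ≤ 49152 * r ^ 3 * (r + 1) *
      ((n : ℝ) ^ ((r : ℝ) - (2 : ℝ) ^ (1 - (r : ℝ))) * Real.log n ^ 6 / ε ^ 2) := by
  classical
  obtain ⟨Y, hY⟩ := exists_sparsity_eq_SPR R n ε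
  rw [hY]
  have : Nonempty (Fin n) := ⟨⟨0, by omega⟩⟩
  have hchain := chainLength_satFamily_le hR Y
  rw [Fintype.card_fin] at hchain
  set k := chainLength (satFamily D R Y)
  set A : ℝ := (n : ℝ) ^ ((r : ℝ) - (2 : ℝ) ^ (1 - (r : ℝ)))
  set L : ℝ := Real.log n with hL
  have hn2 : (2 : ℝ) ≤ n := by exact_mod_cast hn
  have hlog2 : (1 / 2 : ℝ) < Real.log 2 := by linarith [Real.log_two_gt_d9]
  have hL2 : Real.log 2 ≤ L := Real.log_le_log two_pos hn2
  have hLhalf : 1 / 2 ≤ L := by linarith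
  have hr1 : (1 : ℝ) ≤ r := by exact_mod_cast hr
  have hA : 0 ≤ A := by positivity
  set T : ℕ := r * (Nat.log 2 n + 1) with hT
  have hT1 : 1 ≤ T := Nat.mul_pos hr (Nat.succ_pos _)
  have hT1' : (1 : ℝ) ≤ T := by exact_mod_cast hT1
  have hcardβ : Fintype.card (Fin r → Fin n) = n ^ r := by
    rw [Fintype.card_fun, Fintype.card_fin, Fintype.card_fin]
  have hYT : Y.card < 2 ^ T := by
    calc Y.card ≤ n ^ r := hcardβ ▸ card_le_univ Y
      _ < (2 ^ (Nat.log 2 n + 1)) ^ r :=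
        Nat.pow_lt_pow_left (Nat.lt_pow_succ_log_self one_lt_two n) (by omega)
      _ = 2 ^ T := by rw [← pow_mul, mul_comm, hT]
  have hTL : (T : ℝ) ≤ 4 * r * L := by
    have h1 : (2 : ℝ) ^ Nat.log 2 n ≤ n := by exact_mod_cast Nat.pow_log_le_self 2 (by omega)
    have h2 := Real.log_le_log (by positivity) h1
    rw [Real.log_pow, ← hL] at h2
    have h3 : (Nat.log 2 n : ℝ) * (1 / 2) ≤ Nat.log 2 n * Real.log 2 := by gcongr
    have h4 : (Nat.log 2 n : ℝ) + 1 ≤ 4 * L := by linarith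
    rw [hT]
    push_cast
    nlinarith
  set ε' : ℝ := ε / (2 * T) with hε'
  -- Chosen so that `ε' ^ 2 * x = 12 * (r + 1) * log n`, which dominates `12 * log (n ^ r + 1)`.
  set x : ℝ := 48 * (T : ℝ) ^ 2 * (r + 1) * L / ε ^ 2 with hx
  have hxε : ε' ^ 2 * x = 12 * ((r + 1) * L) := by
    rw [hx, hε']; field_simp; ring
  have hx1 : 1 ≤ x := by
    have h1 : (1 : ℝ) ≤ (T : ℝ) ^ 2 := one_le_pow₀ hT1'
    have h2 : 1 ≤ ((r : ℝ) + 1) * L := by nlinarith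
    have h3 : ε ^ 2 ≤ 1 := pow_le_one₀ hε.le hε1.le
    rw [hx, one_le_div (by positivity)]
    nlinarith
  set d : ℕ := ⌈x⌉₊ with hd
  have hxd : x ≤ d := Nat.le_ceil x
  have hdx : (d : ℝ) ≤ 2 * x := by
    have := Nat.ceil_lt_add_one (show 0 ≤ x by linarith)
    linarith
  have hd0 : 0 < d := by
    have : (0 : ℝ) < d := by linarith
    exact_mod_cast this
  have hdε : 12 * Real.log (Fintype.card (Fin r → Fin n) + 1) ≤ ε' ^ 2 * d := by
    have h1 : ((n : ℝ) ^ r + 1) ≤ (n : ℝ) ^ (r + 1) := by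
      have : (1 : ℝ) ≤ (n : ℝ) ^ r := one_le_pow₀ (by linarith)
      rw [pow_succ]
      nlinarith
    have h2 := Real.log_le_log (by positivity) h1
    rw [Real.log_pow, ← hL] at h2
    push_cast at h2
    have h3 : ε' ^ 2 * x ≤ ε' ^ 2 * d := mul_le_mul_of_nonneg_left hxd (by positivity)
    rw [hcardβ]
    push_cast
    linarith
  have hfin : (sparsity R Y ε : ℝ) ≤ T * (d * k) := by
    exact_mod_cast sparsity_le_mul_chainLength R Y hε hε1 hd0 hT1 hYT hdε
  have hT3 : (T : ℝ) ^ 3 ≤ (4 * r * L) ^ 3 := pow_le_pow_left₀ (by linarith) hTL 3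
  -- The construction costs only four logarithms; since `log n ≥ 1/2`, this fits under the stated
  -- sixth power.
  have hL4 : L ^ 4 ≤ 4 * L ^ 6 := by
    have h1 : 1 ≤ 4 * L ^ 2 := by nlinarith
    have h2 : 0 ≤ L ^ 4 := by positivity
    nlinarith
  calc (sparsity R Y ε : ℝ) ≤ T * (d * k) := hfin
    _ ≤ T * (2 * x * (2 * A)) := by gcongr
    _ = (T : ℝ) ^ 3 * (192 * (r + 1) * L * A / ε ^ 2) := by rw [hx]; ring
    _ ≤ (4 * r * L) ^ 3 * (192 * (r + 1) * L * A / ε ^ 2) := by gcongr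
    _ = L ^ 4 * (12288 * r ^ 3 * (r + 1) * A / ε ^ 2) := by ring
    _ ≤ 4 * L ^ 6 * (12288 * r ^ 3 * (r + 1) * A / ε ^ 2) := by gcongr
    _ = 49152 * r ^ 3 * (r + 1) * (A * L ^ 6 / ε ^ 2) := by ring

theorem rpow_mul_log_isLittleO {a δ : ℝ} (hδ : 0 < δ) :
    (fun n : ℕ => (n : ℝ) ^ (a - δ) * Real.log n ^ 6) =o[atTop] fun n : ℕ => (n : ℝ) ^ a := by
  have h1 : (fun x : ℝ => x ^ (a - δ) * Real.log x ^ 6) =o[atTop] fun x : ℝ => x ^ a := by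
    have h2 : (fun x : ℝ => x ^ (a - δ) * Real.log x ^ (6 : ℝ)) =o[atTop]
        fun x : ℝ => x ^ (a - δ) * x ^ δ :=
      (isBigO_refl _ _).mul_isLittleO (isLittleO_log_rpow_rpow_atTop 6 hδ)
    refine (h2.congr' (Eventually.of_forall fun x => ?_) ?_)
    · norm_cast
    · filter_upwards [eventually_gt_atTop 0] with x hx
      rw [← Real.rpow_add hx, sub_add_cancel]
  exact h1.comp_tendsto tendsto_natCast_atTop_atTop

end Sparsity

end CSP

theorem mainTheorem9 (r : ℕ) (hr : 1 ≤ r) :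
    ∃ c : ℝ, 0 < c ∧ ∃ C : ℝ, 0 < C ∧ ∃ N : ℕ,
      ∀ (D : Type*) [Finite D] (R : Set (Fin r → D)) (ε : ℝ), 0 < ε → ε < 1 →
        ((fun n : ℕ => (n : ℝ) ^ r) =O[atTop] (fun n : ℕ => (CSP.SPR R n ε : ℝ)) ↔
          CSP.MeetsBoxOnce R) ∧
        (CSP.MeetsBoxOnce R → ∀ n : ℕ, N ≤ n → c * (n : ℝ) ^ r ≤ (CSP.SPR R n ε : ℝ)) ∧
        (¬ CSP.MeetsBoxOnce R → ∀ n : ℕ, 2 ≤ n →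
          (CSP.SPR R n ε : ℝ) ≤
            C * ((n : ℝ) ^ ((r : ℝ) - (2 : ℝ) ^ (1 - (r : ℝ))) * Real.log n ^ 6 / ε ^ 2)) := by
  have hr1 : (1 : ℝ) ≤ r := by exact_mod_cast hr
  -- The parts have size `n / r` rounded down, which is at least `n / (2 * r)` once `n ≥ r`.
  refine ⟨(1 / (2 * r)) ^ r, by positivity, 49152 * r ^ 3 * (r + 1), by positivity, r, ?_⟩
  intro D _ R ε hε hε1
  have hlower : CSP.MeetsBoxOnce R → ∀ n : ℕ, r ≤ n →
      (1 / (2 * (r : ℝ))) ^ r * (n : ℝ) ^ r ≤ (CSP.SPR R n ε : ℝ) := by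
    intro hR n hn
    have h1 := CSP.pow_le_SPR hR hr hε.le hε1 (Nat.mul_div_le n r)
    have h2 : n ≤ 2 * r * (n / r) := by
      have h3 := Nat.lt_mul_div_succ n (show 0 < r by omega)
      have h4 : 1 ≤ n / r := (Nat.one_le_div_iff (by omega)).2 hn
      nlinarith
    have h3 : 1 / (2 * (r : ℝ)) * n ≤ (n / r : ℕ) := by
      rw [one_div_mul_eq_div, div_le_iff₀ (by positivity), mul_comm]
      exact_mod_cast h2
    calc (1 / (2 * (r : ℝ))) ^ r * (n : ℝ) ^ r = (1 / (2 * (r : ℝ)) * n) ^ r := by rw [mul_pow]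
      _ ≤ ((n / r : ℕ) : ℝ) ^ r := pow_le_pow_left₀ (by positivity) h3 r
      _ ≤ _ := by exact_mod_cast h1
  refine ⟨⟨fun hO => ?_, fun hR => ?_⟩, hlower, fun hR n hn => CSP.SPR_le hR hr hε hε1 hn⟩
  -- Without such a box the upper bound is `o(n ^ r)`, so `n ^ r` would be little-o of itself.
  · by_contra hR
    have h1 : (fun n : ℕ => (CSP.SPR R n ε : ℝ)) =O[atTop]
        fun n : ℕ => (n : ℝ) ^ ((r : ℝ) - (2 : ℝ) ^ (1 - (r : ℝ))) * Real.log n ^ 6 := by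
      refine IsBigO.of_bound (49152 * r ^ 3 * (r + 1) / ε ^ 2) ?_
      filter_upwards [eventually_ge_atTop 2] with n hn
      have h2 : 0 ≤ (n : ℝ) ^ ((r : ℝ) - (2 : ℝ) ^ (1 - (r : ℝ))) * Real.log n ^ 6 := by positivity
      rw [Real.norm_of_nonneg (Nat.cast_nonneg _), Real.norm_of_nonneg h2]
      refine (CSP.SPR_le hR hr hε hε1 hn).trans_eq ?_
      ring
    have h2 := (hO.trans h1).trans_isLittleO
      (CSP.rpow_mul_log_isLittleO (a := (r : ℝ)) (Real.rpow_pos_of_pos two_pos _))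
    simp only [Real.rpow_natCast] at h2
    refine isLittleO_irrefl (Eventually.frequently ?_) h2
    filter_upwards [eventually_gt_atTop 0] with n hn
    positivity
  · refine IsBigO.of_bound ((1 / (2 * (r : ℝ))) ^ r)⁻¹ ?_
    filter_upwards [eventually_ge_atTop r] with n hn
    rw [Real.norm_of_nonneg (by positivity), Real.norm_of_nonneg (Nat.cast_nonneg _),
      ← div_eq_inv_mul, le_div_iff₀ (by positivity), mul_comm]
    exact hlower hR n hn
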